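/- Let $W$ be a finite complex reflection group acting on a finite-dimensional complex vector space $\mathcal V$ of dimension $p$, that is, a finite subgroup of $GL(\mathcal V)$ generated by reflections (automorphisms of finite order whose fixed-point set is a hyperplane). Let $\omega\colon\mathcal V\to\mathbb C^p$ be the orbit map of $W$: its coordinate functions are homogeneous polynomials generating the algebra of $W$-invariant polynomials. Let $\mathcal Y\subseteq\mathcal V$ be an $n$-dimensional embedded complex submanifold (every point of which has dimension $n$; $\mathcal Y$ need be neither closed nor connected), and let $f=\omega|_{\mathcal Y}\colon\mathcal Y\to\mathbb C^p$ be the corresponding reflection mapping. Suppose that $f\colon\mathcal Y\to f(\mathcal Y)$ is proper. Then the following holds. (1) $f$ is generically one-to-one (that is, every point of some open dense subset of $f(\mathcal Y)$ has exactly one preimage) if and only if $$\dim\big((\mathcal Y\cap\sigma\mathcal Y)\setminus\operatorname{Fix}\sigma\big)\le n-1\quad\text{for all }\sigma\in W\setminus\{1\},\qquad(*)$$ where $\dim$ is the complex dimension and $\dim\emptyset=-\infty$. (2) If $(*)$ holds, then every $\sigma\in W$ with $\sigma\mathcal Y=\mathcal Y$ fixes $\mathcal Y$ pointwise. If $\mathcal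 Y$ is connected, the converse holds too, so that $f$ is generically one-to-one if and only if every $\sigma\in W$ stabilizing $\mathcal Y$ fixes $\mathcal Y$ pointwise. -/

import Mathlib

namespace ReflectionMapping

section Groups

variable {V : Type*} [AddCommGroup V] [Module ℂ V]

/-- A (complex) reflection: a linear automorphism of finite order whose fixed points form a
hyperplane. -/
def IsComplexReflection (s : V ≃ₗ[ℂ] V) : Prop :=
  IsOfFinOrder s ∧
    Module.finrank ℂ (LinearMap.fixedSubmodule (s : V →ₗ[ℂ] V)) + 1 = Module.finrank ℂ V

/-- A (complex) reflection group acting on `V`: a finite group of linear automorphisms generated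
by the reflections it contains. -/
structure IsReflectionGroup (W : Subgroup (V ≃ₗ[ℂ] V)) : Prop where
  finite : Finite W
  generated : Subgroup.closure {s : V ≃ₗ[ℂ] V | s ∈ W ∧ IsComplexReflection s} = W

/-- The algebra of polynomial functions on `V`, generated by the linear forms. -/
def polyFunctions (V : Type*) [AddCommGroup V] [Module ℂ V] : Subalgebra ℂ (V → ℂ) :=
  Algebra.adjoin ℂ (Set.range fun (φ : Module.Dual ℂ V) (v : V) => φ v)

/-- The algebra of `W`-invariant polynomial functions on `V`. -/
def invariantPolys (W : Subgroup (V ≃ₗ[ℂ] V)) : Subalgebra ℂ (V → ℂ) where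
  carrier := {g | g ∈ polyFunctions V ∧ ∀ σ ∈ W, ∀ v, g (σ v) = g v}
  mul_mem' := fun {a b} ha hb => ⟨mul_mem ha.1 hb.1, fun σ hσ v => by
    simp only [Pi.mul_apply, ha.2 σ hσ v, hb.2 σ hσ v]⟩
  add_mem' := fun {a b} ha hb => ⟨add_mem ha.1 hb.1, fun σ hσ v => by
    simp only [Pi.add_apply, ha.2 σ hσ v, hb.2 σ hσ v]⟩
  algebraMap_mem' := fun r => ⟨Subalgebra.algebraMap_mem _ r, fun _ _ _ => rfl⟩

/-- `ω` is an orbit map of `W`: its `p = dim V` coordinate functions are homogeneous polynomials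
which generate the algebra of `W`-invariant polynomials. -/
structure IsOrbitMap (W : Subgroup (V ≃ₗ[ℂ] V)) {p : ℕ} (ω : V → (Fin p → ℂ)) : Prop where
  finrank_eq : Module.finrank ℂ V = p
  homogeneous : ∀ i, ∃ d : ℕ, ∀ (c : ℂ) (v : V), ω (c • v) i = c ^ d * ω v i
  generates : Algebra.adjoin ℂ (Set.range fun (i : Fin p) (v : V) => ω v i) = invariantPolys W

end Groups

section Submanifolds

variable {V : Type*} [NormedAddCommGroup V] [NormedSpace ℂ V]

/-- `Y` is an `n`-dimensional (embedded, not necessarily closed or connected) complex submanifold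
of `V`: near each of its points it is the zero set of `dim V - n` regular holomorphic equations
`L = 0`, that is, equations with linearly independent differentials. -/
def IsComplexSubmanifold (n : ℕ) (Y : Set V) : Prop :=
  ∀ y ∈ Y, ∃ (c : ℕ) (U : Set V) (L : V → (Fin c → ℂ)),
    n + c = Module.finrank ℂ V ∧ IsOpen U ∧ y ∈ U ∧ AnalyticOnNhd ℂ L U ∧
    (∀ x ∈ U, Function.Surjective (fderiv ℂ L x)) ∧ Y ∩ U = {x ∈ U | L x = 0}

/-- The complex dimension of a (locally analytic) subset `S` of `V`: the largest dimension of a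
non-empty complex submanifold contained in `S`. It is `⊥` (that is, `-∞`) for the empty set. -/
noncomputable def complexDim (S : Set V) : WithBot ℕ∞ :=
  ⨆ (d : ℕ) (_ : ∃ M : Set V, M.Nonempty ∧ M ⊆ S ∧ IsComplexSubmanifold d M),
    ((d : ℕ∞) : WithBot ℕ∞)

end Submanifolds

/-- The reflection mapping `f = ω|_Y` defined by a submanifold `Y` of `V`. -/
def reflectionMap {V : Type*} {p : ℕ} (ω : V → (Fin p → ℂ)) (Y : Set V) : Y → (Fin p → ℂ) :=
  fun y => ω y

/-- `f` is generically one-to-one: every point of some open dense subset of the image `f(A)`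
(with the subspace topology) has exactly one preimage. -/
def GenericallyOneToOne {A B : Type*} [TopologicalSpace B] (f : A → B) : Prop :=
  ∃ U : Set (Set.range f), IsOpen U ∧ Dense U ∧ ∀ z ∈ U, ∃! a : A, f a = z

end ReflectionMapping

/-! The fibres of `ω` are `W`-orbits (`IsOrbitMap.exists_of_eq`), so `f` fails to be injective at `y
∈ Y` exactly when `y` lies in one of the finitely many sets `(Y ∩ σY) \ Fix σ`. A submanifold of
dimension at least `n` inside `Y` is open in `Y`, so (*) says that these sets have empty interior in
`Y` (`interior_eq_empty_iff`).

Properness makes `Y ∩ σY` closed in `Y`. Under (*) the union of the bad sets is then nowhere dense,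
and the closed map `f` carries its closure to a closed set with dense complement. Conversely, a bad
set with interior spoils a non-empty open part of `f(Y)`, by `exists_isOpen_subset_image`.

For (2), if `σY = Y` the bad set of `σ` is open in `Y`, hence empty under (*). If `Y` is connected
and `σY` contains an open piece of `Y`, the identity theorem and the finite order of `σ` give `σY =
Y`. -/

namespace ReflectionMapping

open Filter Topology

/-! ### Invariant polynomials and fibres of the orbit map -/

section Groups

variable {V : Type*} [AddCommGroup V] [Module ℂ V]

theorem IsOrbitMap.apply_mem_invariantPolys {W : Subgroup (V ≃ₗ[ℂ] V)} {p : ℕ}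
    {ω : V → (Fin p → ℂ)} (hω : IsOrbitMap W ω) (i : Fin p) :
    (fun v => ω v i) ∈ invariantPolys W := by
  rw [← hω.generates]
  exact Algebra.subset_adjoin ⟨i, rfl⟩

theorem IsOrbitMap.map_apply {W : Subgroup (V ≃ₗ[ℂ] V)} {p : ℕ} {ω : V → (Fin p → ℂ)}
    (hω : IsOrbitMap W ω) {σ : V ≃ₗ[ℂ] V} (hσ : σ ∈ W) (v : V) : ω (σ v) = ω v :=
  funext fun i => (hω.apply_mem_invariantPolys i).2 σ hσ v

theorem IsOrbitMap.eq_of_mem_invariantPolys {W : Subgroup (V ≃ₗ[ℂ] V)} {p : ℕ}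
    {ω : V → (Fin p → ℂ)} (hω : IsOrbitMap W ω) {u v : V} (h : ω u = ω v) {g : V → ℂ}
    (hg : g ∈ invariantPolys W) : g u = g v := by
  rw [← hω.generates] at hg
  induction hg using Algebra.adjoin_induction with
  | mem x hx => obtain ⟨i, rfl⟩ := hx; exact congrFun h i
  | algebraMap r => rfl
  | add x y _ _ hx hy => simp [hx, hy]
  | mul x y _ _ hx hy => simp [hx, hy]

theorem comp_mem_polyFunctions {g : V → ℂ} (hg : g ∈ polyFunctions V) (σ : V ≃ₗ[ℂ] V) :
    (fun v => g (σ v)) ∈ polyFunctions V := by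
  induction hg using Algebra.adjoin_induction with
  | mem x hx =>
    obtain ⟨φ, rfl⟩ := hx
    exact Algebra.subset_adjoin ⟨φ.comp (σ : V →ₗ[ℂ] V), rfl⟩
  | algebraMap r => exact Subalgebra.algebraMap_mem _ r
  | add x y _ _ hx hy => exact add_mem hx hy
  | mul x y _ _ hx hy => exact mul_mem hx hy

/-- The product of the translates of a polynomial function by a finite group is an invariant
polynomial function. -/
theorem prod_comp_mem_invariantPolys (W : Subgroup (V ≃ₗ[ℂ] V)) [Fintype W] {g : V → ℂ}
    (hg : g ∈ polyFunctions V) : (fun v => ∏ τ : W, g (τ.1 v)) ∈ invariantPolys W := by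
  refine ⟨?_, fun σ hσ v => ?_⟩
  · have h : (∏ τ : W, fun v => g (τ.1 v)) ∈ polyFunctions V :=
      prod_mem fun τ _ => comp_mem_polyFunctions hg τ.1
    convert h using 1
    ext v
    simp
  · exact Fintype.prod_equiv (Equiv.mulRight (⟨σ, hσ⟩ : W)) _ _ fun τ => rfl

/-- The fibres of an orbit map are orbits. -/
theorem IsOrbitMap.exists_of_eq {W : Subgroup (V ≃ₗ[ℂ] V)} [Finite W] {p : ℕ}
    {ω : V → (Fin p → ℂ)} (hω : IsOrbitMap W ω) {u v : V} (h : ω u = ω v) :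
    ∃ σ ∈ W, σ u = v := by
  have := Fintype.ofFinite W
  by_contra! hne
  -- A linear form separating `v` from the whole orbit of `u`: the invariant `∏ τ, (φ ∘ τ - φ v)`
  -- vanishes at `v` but not at `u`.
  obtain ⟨φ, hφ⟩ := Module.exists_dual_forall_apply_ne_zero (K := ℂ)
    (fun τ : W => τ.1 u - v) fun τ => sub_ne_zero.2 (hne τ.1 τ.2)
  have hg : (fun x => φ x - φ v) ∈ polyFunctions V :=
    sub_mem (Algebra.subset_adjoin ⟨φ, rfl⟩) (Subalgebra.algebraMap_mem _ (φ v))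
  have h₁ := hω.eq_of_mem_invariantPolys h (prod_comp_mem_invariantPolys W hg)
  have h₂ : ∏ τ : W, (φ (τ.1 v) - φ v) = 0 :=
    Finset.prod_eq_zero (Finset.mem_univ 1) (by simp)
  simp only [h₂, Finset.prod_eq_zero_iff] at h₁
  obtain ⟨τ, -, hτ⟩ := h₁
  exact hφ τ (by simpa using hτ)

end Groups

/-! ### Complex submanifolds: parametrization, dimension, identity theorem -/

section Submanifolds

variable {V : Type*} [NormedAddCommGroup V] [NormedSpace ℂ V]

theorem IsComplexSubmanifold.inter_isOpen {n : ℕ} {Y O : Set V} (hY : IsComplexSubmanifold n Y)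
    (hO : IsOpen O) : IsComplexSubmanifold n (Y ∩ O) := by
  rintro y ⟨hy, hyO⟩
  obtain ⟨c, U, L, hc, hU, hyU, hL, hs, hYU⟩ := hY y hy
  refine ⟨c, U ∩ O, L, hc, hU.inter hO, ⟨hyU, hyO⟩, hL.mono Set.inter_subset_left,
    fun x hx => hs x hx.1, ?_⟩
  have h : ∀ x, (x ∈ Y ∩ U ↔ x ∈ U ∧ L x = 0) := fun x => by rw [hYU]; rfl
  ext x
  have := h x
  simp only [Set.mem_inter_iff, Set.mem_ofPred_eq] at *
  tauto

variable [FiniteDimensional ℂ V]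

theorem continuous_of_mem_polyFunctions {g : V → ℂ} (hg : g ∈ polyFunctions V) :
    Continuous g := by
  induction hg using Algebra.adjoin_induction with
  | mem x hx => obtain ⟨φ, rfl⟩ := hx; exact φ.continuous_of_finiteDimensional
  | algebraMap r => exact continuous_const
  | add x y _ _ hx hy => exact hx.add hy
  | mul x y _ _ hx hy => exact hx.mul hy

theorem IsOrbitMap.continuous {W : Subgroup (V ≃ₗ[ℂ] V)} {p : ℕ} {ω : V → (Fin p → ℂ)}
    (hω : IsOrbitMap W ω) : Continuous ω :=
  continuous_pi fun i => continuous_of_mem_polyFunctions (hω.apply_mem_invariantPolys i).1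

/-- The zero set of regular holomorphic equations is locally parametrized by the projection to
its tangent space. -/
theorem exists_local_parametrization {F : Type*} [NormedAddCommGroup F] [NormedSpace ℂ F]
    [FiniteDimensional ℂ F] {L : V → F} {y : V} (hL : AnalyticAt ℂ L y)
    (hs : Function.Surjective (fderiv ℂ L y)) (hy : L y = 0) {T : Submodule ℂ V}
    (hT : (fderiv ℂ L y : V →ₗ[ℂ] F).ker = T) (π : V →L[ℂ] T) (hπ : ∀ t : T, π t = t)
    {O : Set V} (hO : O ∈ 𝓝 y) :
    ∃ (B : Set T) (g : T → V), B ∈ 𝓝 (π y) ∧ IsPreconnected B ∧ AnalyticOnNhd ℂ g B ∧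
      (∀ t ∈ B, g t ∈ O ∧ L (g t) = 0 ∧ π (g t) = t) ∧
      g (π y) = y ∧ ∀ᶠ b in 𝓝 y, L b = 0 → g (π b) = b := by
  have := FiniteDimensional.complete ℂ V
  have hmem : ∀ v, v ∈ T ↔ fderiv ℂ L y v = 0 := fun v => by rw [← hT]; rfl
  have hbij : Function.Bijective ((fderiv ℂ L y).prod π) := by
    constructor
    · rw [injective_iff_map_eq_zero]
      intro v hv
      simp only [ContinuousLinearMap.prod_apply, Prod.mk_eq_zero] at hv
      simpa [hv.2] using (congrArg Subtype.val (hπ ⟨v, (hmem v).2 hv.1⟩)).symm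
    · rintro ⟨a, t⟩
      obtain ⟨v, rfl⟩ := hs a
      refine ⟨v - π v + t, ?_⟩
      have h : ∀ s : T, fderiv ℂ L y s = 0 := fun s => (hmem s).1 s.2
      simp [h, hπ]
  let A : V ≃L[ℂ] F × T :=
    (LinearEquiv.ofBijective (((fderiv ℂ L y).prod π : V →L[ℂ] F × T) : V →ₗ[ℂ] F × T)
      hbij).toContinuousLinearEquiv
  have hA : (A : V →L[ℂ] F × T) = (fderiv ℂ L y).prod π := by ext v <;> rfl
  -- Inverse function theorem for `(L, π)`; `g` is the local inverse restricted to `{0} × T`.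
  have hΦ : HasStrictFDerivAt (fun b => (L b, π b)) (A : V →L[ℂ] F × T) y := by
    rw [hA]
    exact hL.hasStrictFDerivAt.prodMk π.hasStrictFDerivAt
  have hΦa : AnalyticAt ℂ (fun b => (L b, π b)) y := hL.prod (π.analyticAt y)
  set e := hΦ.toOpenPartialHomeomorph (fun b => (L b, π b)) with he
  have hey : y ∈ e.source := hΦ.mem_toOpenPartialHomeomorph_source
  have hecoe : ∀ b, e b = (L b, π b) := fun b => rfl
  have hsymm : AnalyticAt ℂ e.symm (0, π y) := by
    have := e.analyticAt_symm' (i := A) hey hΦa hΦ.hasFDerivAt.fderiv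
    rwa [hecoe, hy] at this
  have hg : AnalyticAt ℂ (fun t : T => e.symm (0, t)) (π y) :=
    AnalyticAt.fun_comp (f := fun t : T => ((0 : F), t)) hsymm (analyticAt_const.prod analyticAt_id)
  have hgy : e.symm (0, π y) = y := by
    have := e.left_inv hey
    rwa [hecoe, hy] at this
  have htarget : ∀ᶠ t in 𝓝 (π y), ((0 : F), t) ∈ e.target := by
    have : Continuous fun t : T => ((0 : F), t) := by fun_prop
    refine this.continuousAt.eventually_mem (e.open_target.mem_nhds ?_)
    have := e.map_source hey
    rwa [hecoe, hy] at this
  have hgO : ∀ᶠ t in 𝓝 (π y), e.symm (0, t) ∈ O :=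
    hg.continuousAt.eventually_mem (by rwa [hgy])
  obtain ⟨r, hr, hB⟩ := Metric.eventually_nhds_iff_ball.1
    (hg.eventually_analyticAt.and (htarget.and hgO))
  refine ⟨Metric.ball (π y) r, fun t => e.symm (0, t), Metric.ball_mem_nhds _ hr, ?_,
    fun t ht => (hB t ht).1, fun t ht => ⟨(hB t ht).2.2, ?_⟩, hgy, ?_⟩
  · let : NormedSpace ℝ T := NormedSpace.restrictScalars ℝ ℂ T
    exact (convex_ball (π y) r).isPreconnected
  · have := e.right_inv (hB t ht).2.1
    rw [hecoe] at this
    exact Prod.ext_iff.1 this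
  · filter_upwards [e.open_source.mem_nhds hey] with b hb hb0
    have := e.left_inv hb
    rwa [hecoe, hb0] at this

theorem exists_projection (T : Submodule ℂ V) : ∃ π : V →L[ℂ] T, ∀ t : T, π t = t :=
  Submodule.ClosedComplemented.of_finiteDimensional T

theorem finrank_ker_fderiv {n c : ℕ} (hc : n + c = Module.finrank ℂ V) {L : V → (Fin c → ℂ)}
    {y : V} (hs : Function.Surjective (fderiv ℂ L y)) :
    Module.finrank ℂ (fderiv ℂ L y : V →ₗ[ℂ] (Fin c → ℂ)).ker = n := by
  have h := LinearMap.finrank_range_add_finrank_ker (fderiv ℂ L y : V →ₗ[ℂ] (Fin c → ℂ))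
  rw [LinearMap.range_eq_top.2 hs, finrank_top, Module.finrank_fin_fun] at h
  omega

theorem IsComplexSubmanifold.image_linearEquiv {n : ℕ} {Y : Set V}
    (hY : IsComplexSubmanifold n Y) (σ : V ≃ₗ[ℂ] V) : IsComplexSubmanifold n (σ '' Y) := by
  rintro _ ⟨y, hy, rfl⟩
  obtain ⟨c, U, L, hc, hU, hyU, hL, hs, hYU⟩ := hY y hy
  let τ : V ≃L[ℂ] V := σ.symm.toContinuousLinearEquiv
  have hτ : ∀ x, τ x = σ.symm x := fun x => rfl
  have hfd : ∀ x, τ x ∈ U →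
      fderiv ℂ (fun x => L (τ x)) x = (fderiv ℂ L (τ x)).comp (τ : V →L[ℂ] V) := fun x hx =>
    ((hL _ hx).differentiableAt.hasFDerivAt.comp x τ.hasFDerivAt).fderiv
  refine ⟨c, τ ⁻¹' U, fun x => L (τ x), hc, hU.preimage τ.continuous, by simpa [hτ] using hyU,
    fun x hx => (hL _ hx).fun_comp (τ.analyticAt x), fun x hx => ?_, ?_⟩
  · rw [hfd x hx]
    exact (hs _ hx).comp τ.surjective
  · have h : ∀ x, (x ∈ Y ∩ U ↔ x ∈ U ∧ L x = 0) := fun x => by rw [hYU]; rfl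
    ext x
    have hx : x ∈ σ '' Y ↔ τ x ∈ Y := by
      rw [hτ, LinearEquiv.image_eq_preimage_symm]; rfl
    simpa [hx] using h (τ x)

/-- A submanifold is a neighbourhood of each of its points in any submanifold of at most the
same dimension which contains it. -/
theorem IsComplexSubmanifold.mem_nhdsWithin {n d : ℕ} {Y M : Set V}
    (hY : IsComplexSubmanifold n Y) (hM : IsComplexSubmanifold d M) (hnd : n ≤ d)
    (hMY : M ⊆ Y) {x : V} (hx : x ∈ M) : M ∈ 𝓝[Y] x := by
  obtain ⟨c, U, L, hc, hU, hxU, hL, hs, hYU⟩ := hY x (hMY hx)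
  obtain ⟨c', U', L', hc', hU', hxU', hL', hs', hMU'⟩ := hM x hx
  have hY' : ∀ b ∈ U, (b ∈ Y ↔ L b = 0) := fun b hb => by
    have := Set.ext_iff.1 hYU b
    simpa [hb] using this
  have hM' : ∀ b ∈ U', (b ∈ M ↔ L' b = 0) := fun b hb => by
    have := Set.ext_iff.1 hMU' b
    simpa [hb] using this
  have hLx := (hY' x hxU).1 (hMY hx)
  have hLx' := (hM' x hxU').1 hx
  set T := (fderiv ℂ L' x : V →ₗ[ℂ] (Fin c' → ℂ)).ker
  obtain ⟨π, hπ⟩ := exists_projection T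
  obtain ⟨B, g, hB, -, hg, hgB, hgx, -⟩ := exists_local_parametrization (hL' x hxU')
    (hs' x hxU') hLx' rfl π hπ ((hU.inter hU').mem_nhds ⟨hxU, hxU'⟩)
  have hgM : ∀ t ∈ B, g t ∈ M := fun t ht => (hM' _ (hgB t ht).1.2).2 (hgB t ht).2.1
  have hgx' : AnalyticAt ℂ g (π x) := hg _ (mem_of_mem_nhds hB)
  have hT : (fderiv ℂ L x : V →ₗ[ℂ] (Fin c → ℂ)).ker = T := by
    refine (Submodule.eq_of_le_of_finrank_le ?_ ?_).symm
    · -- `L ∘ g` vanishes near `π x`, and the derivative of `g` is the inclusion of `T`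
      have h₁ : (fun t => L (g t)) =ᶠ[𝓝 (π x)] fun _ => 0 := by
        filter_upwards [hB] with t ht
        exact (hY' _ (hgB t ht).1.1).1 (hMY (hgM t ht))
      have h₂ : (fun t => L' (g t)) =ᶠ[𝓝 (π x)] fun _ => 0 := by
        filter_upwards [hB] with t ht using (hgB t ht).2.1
      have h₃ : (fun t => π (g t)) =ᶠ[𝓝 (π x)] fun t => t := by
        filter_upwards [hB] with t ht using (hgB t ht).2.2
      have hd := hgx'.differentiableAt.hasFDerivAt
      have hLd : HasFDerivAt L (fderiv ℂ L x) (g (π x)) := by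
        rw [hgx]; exact (hL x hxU).differentiableAt.hasFDerivAt
      have hLd' : HasFDerivAt L' (fderiv ℂ L' x) (g (π x)) := by
        rw [hgx]; exact (hL' x hxU').differentiableAt.hasFDerivAt
      have e₁ := (hLd.comp (π x) hd).unique
        ((hasFDerivAt_const (0 : Fin c → ℂ) (π x)).congr_of_eventuallyEq h₁)
      have e₂ := (hLd'.comp (π x) hd).unique
        ((hasFDerivAt_const (0 : Fin c' → ℂ) (π x)).congr_of_eventuallyEq h₂)
      have e₃ := (π.hasFDerivAt.comp (π x) hd).unique
        ((hasFDerivAt_id (π x)).congr_of_eventuallyEq h₃)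
      intro t ht
      have hmem : fderiv ℂ g (π x) ⟨t, ht⟩ ∈ T := by
        exact LinearMap.mem_ker.2 (DFunLike.congr_fun e₂ ⟨t, ht⟩)
      have h₄ : fderiv ℂ g (π x) ⟨t, ht⟩ = t := by
        have h₅ : π (fderiv ℂ g (π x) ⟨t, ht⟩) = ⟨t, ht⟩ := by
          simpa using DFunLike.congr_fun e₃ ⟨t, ht⟩
        rw [hπ ⟨_, hmem⟩] at h₅
        exact congrArg Subtype.val h₅
      have h₆ := DFunLike.congr_fun e₁ ⟨t, ht⟩
      simpa [h₄] using h₆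
    · rw [finrank_ker_fderiv hc (hs x hxU), finrank_ker_fderiv hc' (hs' x hxU')]
      exact hnd
  -- As the tangent spaces agree, the same `π` is injective on `Y` near `x`. A point `b ∈ Y` and the
  -- point `g (π b)` of `M ⊆ Y` have equal projections, so they coincide.
  obtain ⟨B', g', hB', -, -, -, -, hg'⟩ := exists_local_parametrization (hL x hxU)
    (hs x hxU) hLx hT π hπ (hU.mem_nhds hxU)
  have hπx : Tendsto π (𝓝 x) (𝓝 (π x)) := π.continuous.continuousAt
  have hgπ : Tendsto (fun b => g (π b)) (𝓝 x) (𝓝 x) := by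
    have := hgx'.continuousAt.tendsto.comp hπx
    rwa [hgx] at this
  rw [mem_nhdsWithin_iff_eventually]
  filter_upwards [hU.mem_nhds hxU, hg', hgπ.eventually hg', hπx.eventually_mem hB]
    with b hbU hb hgb hbB hbY
  have h₁ := hb ((hY' b hbU).1 hbY)
  have h₂ := hgb ((hY' _ (hgB _ hbB).1.1).1 (hMY (hgM _ hbB)))
  rw [(hgB _ hbB).2.2, h₁] at h₂
  rw [h₂]
  exact hgM _ hbB

/-- The identity theorem on a submanifold. -/
theorem IsComplexSubmanifold.eventually_eq_zero {n : ℕ} {Y : Set V}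
    (hY : IsComplexSubmanifold n Y) {y : V} (hy : y ∈ Y) {F : Type*} [NormedAddCommGroup F]
    [NormedSpace ℂ F] [CompleteSpace F] {H : V → F} (hH : AnalyticAt ℂ H y)
    (hfreq : ∃ᶠ a in 𝓝[Y] y, ∀ᶠ b in 𝓝[Y] a, H b = 0) : ∀ᶠ b in 𝓝[Y] y, H b = 0 := by
  obtain ⟨c, U, L, hc, hU, hyU, hL, hs, hYU⟩ := hY y hy
  have hY' : ∀ b ∈ U, (b ∈ Y ↔ L b = 0) := fun b hb => by
    have := Set.ext_iff.1 hYU b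
    simpa [hb] using this
  obtain ⟨π, hπ⟩ := exists_projection (fderiv ℂ L y : V →ₗ[ℂ] (Fin c → ℂ)).ker
  obtain ⟨B, g, hB, hBc, hg, hgB, -, hgπ⟩ := exists_local_parametrization (hL y hyU)
    (hs y hyU) ((hY' y hyU).1 hy) rfl π hπ
    (inter_mem (hU.mem_nhds hyU) hH.eventually_analyticAt)
  have hπy : ∀ᶠ b in 𝓝 y, π b ∈ B := π.continuous.continuousAt.eventually_mem hB
  have hnear : ∀ᶠ b in 𝓝[Y] y, (b ∈ Y ∧ π b ∈ B ∧ g (π b) = b) ∧ B ∈ 𝓝 (π b) := by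
    have hπy' : ∀ᶠ b in 𝓝 y, B ∈ 𝓝 (π b) :=
      π.continuous.continuousAt.eventually (eventually_mem_nhds_iff.2 hB)
    filter_upwards [self_mem_nhdsWithin, nhdsWithin_le_nhds hπy, nhdsWithin_le_nhds hgπ,
      nhdsWithin_le_nhds (hU.mem_nhds hyU), nhdsWithin_le_nhds hπy'] with b h₁ h₂ h₃ h₄ h₅
    exact ⟨⟨h₁, h₂, h₃ ((hY' b h₄).1 h₁)⟩, h₅⟩
  obtain ⟨a, ha, ⟨haY, haB, hga⟩, hBa⟩ := (hfreq.and_eventually hnear).exists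
  have hcomp : AnalyticOnNhd ℂ (fun t => H (g t)) B := fun t ht =>
    AnalyticAt.fun_comp (hgB t ht).1.2 (hg t ht)
  have hga' : Tendsto g (𝓝 (π a)) (𝓝[Y] a) := by
    refine tendsto_nhdsWithin_iff.2 ⟨?_, ?_⟩
    · have := (hg _ haB).continuousAt.tendsto
      rwa [hga] at this
    · filter_upwards [hBa] with t ht using (hY' _ (hgB t ht).1.1).2 (hgB t ht).2.1
  have hzero := hcomp.eqOn_zero_of_preconnected_of_eventuallyEq_zero hBc haB (hga'.eventually ha)
  filter_upwards [hnear] with b hb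
  have := hzero hb.1.2.1
  simpa [hb.1.2.2] using this

/-- An open piece of `Y` is an `n`-dimensional submanifold; conversely `mem_nhdsWithin` makes any
submanifold of dimension at least `n` in `S` open in `Y`. Adding 1 on the left avoids subtraction in
`WithBot ℕ∞`. -/
theorem IsComplexSubmanifold.interior_eq_empty_iff {n : ℕ} {Y : Set V}
    (hY : IsComplexSubmanifold n Y) {S : Set V} (hS : S ⊆ Y) :
    complexDim S + 1 ≤ (n : WithBot ℕ∞) ↔ interior ((↑) ⁻¹' S : Set Y) = ∅ := by
  have hdim : complexDim S + 1 ≤ (n : WithBot ℕ∞) ↔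
      ∀ d (M : Set V), M.Nonempty → M ⊆ S → IsComplexSubmanifold d M → d + 1 ≤ n := by
    constructor
    · intro h d M hM hMS hMd
      have h₁ : ((d : ℕ∞) : WithBot ℕ∞) ≤ complexDim S :=
        le_iSup₂_of_le d ⟨M, hM, hMS, hMd⟩ le_rfl
      have h₂ : ((d : ℕ∞) : WithBot ℕ∞) + 1 ≤ n := (add_le_add_left h₁ 1).trans h
      exact_mod_cast h₂
    · intro h
      -- For `n = 0` the bound has to be `⊥`, not the truncated `n - 1 = 0`.
      have h₁ : complexDim S ≤ if n = 0 then ⊥ else (((n - 1 : ℕ) : ℕ∞) : WithBot ℕ∞) := by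
        refine iSup₂_le fun d ⟨M, hM, hMS, hMd⟩ => ?_
        have h₂ := h d M hM hMS hMd
        rw [if_neg (by omega)]
        have h₃ : d ≤ n - 1 := by omega
        exact_mod_cast h₃
      refine (add_le_add_left h₁ 1).trans ?_
      split_ifs with hn
      · simp
      · have h₃ : n - 1 + 1 ≤ n := by omega
        exact_mod_cast h₃
  rw [hdim, Set.eq_empty_iff_forall_notMem]
  constructor
  · intro h y hy
    obtain ⟨O', hO', hO, hyO⟩ := mem_interior.1 hy
    obtain ⟨O, hOo, rfl⟩ := isOpen_induced_iff.1 hO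
    have := h n (Y ∩ O) ⟨y, y.2, hyO⟩ (fun v hv => hO' (a := ⟨v, hv.1⟩) hv.2)
      (hY.inter_isOpen hOo)
    omega
  · intro h d M ⟨x, hx⟩ hMS hMd
    by_contra hlt
    have h₁ := hY.mem_nhdsWithin hMd (by omega) (hMS.trans hS) hx
    refine h ⟨x, hS (hMS hx)⟩ (mem_interior_iff_mem_nhds.2 ?_)
    exact preimage_coe_mem_nhds_subtype.2 (mem_of_superset h₁ hMS)

end Submanifolds

/-! ### Nowhere dense sets -/

section Topology

variable {X : Type*} [TopologicalSpace X]

theorem isNowhereDense_inter_of_isClosed_of_isOpen {C O : Set X} (hC : IsClosed C)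
    (hO : IsOpen O) (h : interior (C ∩ O) = ∅) : IsNowhereDense (C ∩ O) := by
  have hCO : interior C ∩ O = ∅ := by
    rwa [interior_inter, hO.interior_eq] at h
  rw [isNowhereDense_iff_disjoint]
  refine Set.disjoint_left.2 fun x hx hx' => Set.notMem_empty x (hCO ▸ ⟨?_, hx.2⟩)
  exact interior_mono (closure_minimal Set.inter_subset_left hC) hx'

theorem IsNowhereDense.iUnion_of_finite {ι : Type*} [Finite ι] {s : ι → Set X}
    (hs : ∀ i, IsNowhereDense (s i)) : IsNowhereDense (⋃ i, s i) := by
  rw [IsNowhereDense, closure_iUnion_of_finite, interior_eq_empty_iff_dense_compl,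
    Set.compl_iUnion, ← Set.sInter_range]
  refine (Set.finite_range _).dense_sInter ?_ ?_
  · rintro _ ⟨i, rfl⟩
    exact isClosed_closure.isOpen_compl
  · rintro _ ⟨i, rfl⟩
    exact interior_eq_empty_iff_dense_compl.1 (hs i)

theorem dense_interior_union_compl {C : Set X} (hC : IsClosed C) : Dense (interior C ∪ Cᶜ) := by
  have h := interior_eq_empty_iff_dense_compl.1 (interior_frontier hC)
  rwa [hC.frontier_eq, Set.sdiff_eq, Set.compl_inter, compl_compl, Set.union_comm] at h

end Topology

/-! ### Proper reflection mappings -/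

section Proper

variable {V : Type*} [NormedAddCommGroup V] [NormedSpace ℂ V]
  {W : Subgroup (V ≃ₗ[ℂ] V)} {p : ℕ} {ω : V → (Fin p → ℂ)} {Y : Set V}

/-- The points of `Y` at which `f` takes a value that it also takes at another point. -/
theorem exists_ne_iff [Finite W] (hω : IsOrbitMap W ω) (y : Y) :
    (∃ w : Y, reflectionMap ω Y w = reflectionMap ω Y y ∧ w ≠ y) ↔
      ∃ σ ∈ W, (y : V) ∈ (Y ∩ σ '' Y) \ {v | σ v = v} := by
  constructor
  · rintro ⟨w, hw, hne⟩
    obtain ⟨σ, hσ, hσw⟩ := hω.exists_of_eq hw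
    refine ⟨σ, hσ, ⟨y.2, w, w.2, hσw⟩, fun h => hne (Subtype.ext (σ.injective ?_))⟩
    exact hσw.trans h.symm
  · rintro ⟨σ, hσ, ⟨-, w, hw, hσw⟩, hne⟩
    refine ⟨⟨w, hw⟩, (hω.map_apply hσ w).symm.trans (congrArg ω hσw), fun h => hne ?_⟩
    have h' : w = y := congrArg Subtype.val h
    exact h' ▸ hσw

variable [FiniteDimensional ℂ V]

/-- If `σ w → y` with `w ∈ Y`, then `f w = ω (σ w) → f y`, so properness yields a limit `x ∈ Y` of
the `w` along an ultrafilter, and `σ x = y`. -/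
theorem mem_image_of_mem_closure (hω : IsOrbitMap W ω)
    (hproper : IsProperMap (Set.rangeFactorization (reflectionMap ω Y))) {σ : V ≃ₗ[ℂ] V}
    (hσ : σ ∈ W) {y : V} (hy : y ∈ Y) (hcl : y ∈ closure (σ '' Y)) : y ∈ σ '' Y := by
  have hσc : Continuous σ := σ.toContinuousLinearEquiv.continuous
  have hne : (comap (fun w : Y => σ w) (𝓝 y)).NeBot := by
    rw [comap_neBot_iff]
    intro t ht
    obtain ⟨_, hv, w, hw, rfl⟩ := mem_closure_iff_nhds.1 hcl t ht
    exact ⟨⟨w, hw⟩, hv⟩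
  let 𝒰 := Ultrafilter.of (comap (fun w : Y => σ w) (𝓝 y))
  have h𝒰 : Tendsto (fun w : Y => σ w) 𝒰 (𝓝 y) :=
    tendsto_comap.mono_left (Ultrafilter.of_le _)
  have hf : Tendsto (Set.rangeFactorization (reflectionMap ω Y)) 𝒰
      (𝓝 (Set.rangeFactorization (reflectionMap ω Y) ⟨y, hy⟩)) := by
    rw [tendsto_subtype_rng]
    have := (hω.continuous.tendsto y).comp h𝒰
    simpa [Function.comp_def, hω.map_apply hσ, reflectionMap] using this
  obtain ⟨x, -, hx⟩ := hproper.ultrafilter_le_nhds_of_tendsto hf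
  have hlim : Tendsto (fun w : Y => σ w) 𝒰 (𝓝 (σ x)) :=
    ((hσc.comp continuous_subtype_val).tendsto x).mono_left hx
  exact ⟨x, x.2, tendsto_nhds_unique hlim h𝒰⟩

theorem isClosed_preimage_image (hω : IsOrbitMap W ω)
    (hproper : IsProperMap (Set.rangeFactorization (reflectionMap ω Y))) {σ : V ≃ₗ[ℂ] V}
    (hσ : σ ∈ W) : IsClosed ((↑) ⁻¹' (σ '' Y) : Set Y) := by
  refine isClosed_of_closure_subset fun y hy => mem_image_of_mem_closure hω hproper hσ y.2 ?_
  exact closure_mono (Set.image_preimage_subset _ _)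
    (image_closure_subset_closure_image continuous_subtype_val ⟨y, hy, rfl⟩)

/-- The image of a non-empty open subset of `Y` contains a non-empty open subset of `f(Y)`. -/
theorem exists_isOpen_subset_image [Finite W] {n : ℕ} (hω : IsOrbitMap W ω)
    (hY : IsComplexSubmanifold n Y)
    (hproper : IsProperMap (Set.rangeFactorization (reflectionMap ω Y))) {O : Set Y}
    (hO : IsOpen O) (hne : O.Nonempty) :
    ∃ Z : Set (Set.range (reflectionMap ω Y)), IsOpen Z ∧ Z.Nonempty ∧
      Z ⊆ Set.rangeFactorization (reflectionMap ω Y) '' O := by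
  -- At a generic `y`, each `σY` either contains a neighbourhood of `y` in `Y` or misses `y`.
  have hdense : Dense (⋂ σ : W, (interior ((↑) ⁻¹' (σ.1 '' Y) : Set Y) ∪
      ((↑) ⁻¹' (σ.1 '' Y) : Set Y)ᶜ)) := by
    have hcl := fun σ : W => isClosed_preimage_image hω hproper σ.2
    rw [← Set.sInter_range]
    refine (Set.finite_range _).dense_sInter ?_ ?_
    · rintro _ ⟨σ, rfl⟩
      exact isOpen_interior.union (hcl σ).isOpen_compl
    · rintro _ ⟨σ, rfl⟩
      exact dense_interior_union_compl (hcl σ)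
  obtain ⟨y, hyO, hy⟩ := hdense.exists_mem_open hO hne |>.imp fun y hy => hy.symm
  rw [Set.mem_iInter] at hy
  have hYO : ((↑) '' O : Set V) ∈ 𝓝[Y] (y : V) := by
    rw [← map_nhds_subtype_val]
    exact image_mem_map (hO.mem_nhds hyO)
  -- In the first case `Y` and `σY`, having equal dimension, have the same germ at `y`; in the
  -- second `σY` stays away from `y`.
  have hnear : ∀ σ : W, ∀ᶠ v in 𝓝 (y : V), v ∈ σ.1 '' Y → v ∈ ((↑) '' O : Set V) := by
    intro σ
    rcases hy σ with h | h
    · rw [mem_interior_iff_mem_nhds, preimage_coe_mem_nhds_subtype] at h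
      obtain ⟨N, hN, hyN, hNY⟩ := mem_nhdsWithin.1 h
      have h₁ : Y ∩ N ∈ 𝓝[σ.1 '' Y] (y : V) :=
        (hY.image_linearEquiv σ.1).mem_nhdsWithin (hY.inter_isOpen hN) le_rfl
          (fun v hv => hNY hv.symm) ⟨y.2, hyN⟩
      exact mem_nhdsWithin_iff_eventually.1
        (nhdsWithin_le_of_mem (mem_of_superset h₁ Set.inter_subset_left) hYO)
    · have h₁ : (y : V) ∉ closure (σ.1 '' Y) := fun h₂ =>
        h (mem_image_of_mem_closure hω hproper σ.2 y.2 h₂)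
      filter_upwards [isClosed_closure.isOpen_compl.mem_nhds h₁] with v hv hv'
      exact absurd (subset_closure hv') hv
  obtain ⟨N, hN, hNo, hyN⟩ := eventually_nhds_iff.1 (eventually_all.2 hnear)
  -- The points whose orbit meets `N`. A value not taken on the complement of `P` is taken at a
  -- point of `N ∩ σY ⊆ O`.
  let P : Set Y := {w | ∃ σ ∈ W, σ w ∈ N}
  have hP : IsOpen P := by
    have : P = ⋃ σ ∈ W, (fun w : Y => σ w) ⁻¹' N := by ext; simp [P]
    rw [this]
    exact isOpen_biUnion fun σ _ => hNo.preimage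
      (σ.toContinuousLinearEquiv.continuous.comp continuous_subtype_val)
  refine ⟨(Set.rangeFactorization (reflectionMap ω Y) '' Pᶜ)ᶜ,
    (hproper.isClosedMap _ hP.isClosed_compl).isOpen_compl,
    ⟨Set.rangeFactorization (reflectionMap ω Y) y, ?_⟩, ?_⟩
  · rintro ⟨w, hw, hwy⟩
    obtain ⟨σ, hσ, hσw⟩ := hω.exists_of_eq (congrArg Subtype.val hwy)
    exact hw ⟨σ, hσ, hσw ▸ hyN⟩
  · rintro z hz
    obtain ⟨w, rfl⟩ := Set.rangeFactorization_surjective z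
    have hw : w ∈ P := by
      by_contra h
      exact hz ⟨w, h, rfl⟩
    obtain ⟨σ, hσ, hσw⟩ := hw
    obtain ⟨u, hu, huw⟩ := hN _ hσw ⟨σ, hσ⟩ ⟨w, w.2, rfl⟩
    exact ⟨u, hu, Subtype.ext ((congrArg ω huw).trans (hω.map_apply hσ w))⟩

theorem genericallyOneToOne_iff_interior [Finite W] {n : ℕ} (hω : IsOrbitMap W ω)
    (hY : IsComplexSubmanifold n Y)
    (hproper : IsProperMap (Set.rangeFactorization (reflectionMap ω Y))) :
    GenericallyOneToOne (reflectionMap ω Y) ↔ ∀ σ ∈ W,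
      interior ((↑) ⁻¹' ((Y ∩ σ '' Y) \ {v | σ v = v}) : Set Y) = ∅ := by
  constructor
  · rintro ⟨U, hU, hUd, hU1⟩ σ hσ
    by_contra hne
    obtain ⟨Z, hZ, hZne, hZs⟩ := exists_isOpen_subset_image hω hY hproper isOpen_interior
      (Set.nonempty_iff_ne_empty.2 hne)
    obtain ⟨z, hzZ, hzU⟩ := hUd.inter_open_nonempty Z hZ hZne
    obtain ⟨y, hy, rfl⟩ := hZs hzZ
    obtain ⟨w, hw, hwy⟩ := (exists_ne_iff hω y).2 ⟨σ, hσ, (interior_subset hy :)⟩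
    exact hwy ((hU1 _ hzU).unique hw rfl)
  · intro h
    let B : Set Y := ⋃ σ : W, (↑) ⁻¹' ((Y ∩ σ.1 '' Y) \ {v | σ.1 v = v})
    have hB : IsNowhereDense B := by
      refine IsNowhereDense.iUnion_of_finite fun σ => ?_
      have h₁ : ((↑) ⁻¹' ((Y ∩ σ.1 '' Y) \ {v | σ.1 v = v}) : Set Y) =
          (↑) ⁻¹' (σ.1 '' Y) ∩ {y : Y | σ.1 y = y}ᶜ := by
        ext y; simp
      have h₂ := h σ.1 σ.2
      rw [h₁] at h₂ ⊢
      refine isNowhereDense_inter_of_isClosed_of_isOpen (isClosed_preimage_image hω hproper σ.2)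
        (isClosed_eq ?_ continuous_subtype_val).isOpen_compl h₂
      exact σ.1.toContinuousLinearEquiv.continuous.comp continuous_subtype_val
    have hBmem : ∀ y w : Y, reflectionMap ω Y w = reflectionMap ω Y y → w ≠ y → y ∈ B := by
      intro y w hw hne
      obtain ⟨σ, hσ, hy⟩ := (exists_ne_iff hω y).1 ⟨w, hw, hne⟩
      exact Set.mem_iUnion.2 ⟨⟨σ, hσ⟩, hy⟩
    refine ⟨(Set.rangeFactorization (reflectionMap ω Y) '' closure B)ᶜ,
      (hproper.isClosedMap _ isClosed_closure).isOpen_compl, ?_, ?_⟩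
    · rw [← interior_eq_empty_iff_dense_compl, Set.eq_empty_iff_forall_notMem]
      intro z hz
      obtain ⟨y, rfl⟩ := Set.rangeFactorization_surjective z
      -- If `f w = f b` with `b ∈ closure B`, then `w = b` or `w` is itself a bad point.
      have hsub : Set.rangeFactorization (reflectionMap ω Y) ⁻¹'
          interior (Set.rangeFactorization (reflectionMap ω Y) '' closure B) ⊆ closure B := by
        intro w hw
        obtain ⟨b, hb, hbw⟩ := interior_subset hw
        by_cases hne : b = w
        · exact hne ▸ hb
        · exact subset_closure (hBmem w b (congrArg Subtype.val hbw) hne)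
      have := interior_maximal hsub (isOpen_interior.preimage hproper.continuous) hz
      rw [hB] at this
      exact this
    · intro z hz
      obtain ⟨y, rfl⟩ := Set.rangeFactorization_surjective z
      refine ⟨y, rfl, fun w hw => ?_⟩
      by_contra hne
      exact hz ⟨y, subset_closure (hBmem y w hw hne), rfl⟩

/-- If `σ Y` contains a non-empty open subset of the connected submanifold `Y`, then `σ`
stabilizes `Y`. -/
theorem image_eq_of_interior_nonempty [Finite W] {n : ℕ} (hω : IsOrbitMap W ω)
    (hY : IsComplexSubmanifold n Y)
    (hproper : IsProperMap (Set.rangeFactorization (reflectionMap ω Y)))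
    (hconn : IsPreconnected Y) {σ : V ≃ₗ[ℂ] V} (hσ : σ ∈ W)
    (hne : (interior ((↑) ⁻¹' (σ '' Y) : Set Y)).Nonempty) : σ '' Y = Y := by
  -- At a limit point `y`, which lies in `σY`, the local equations of `σY` vanish on open pieces of
  -- `Y` accumulating at `y`, hence on `Y` near `y`.
  have hclosed : IsClosed (interior ((↑) ⁻¹' (σ '' Y) : Set Y)) := by
    refine isClosed_of_closure_subset fun y hy => ?_
    have hyσ : (y : V) ∈ σ '' Y := (isClosed_preimage_image hω hproper hσ).closure_subset
      (closure_mono interior_subset hy)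
    obtain ⟨c, U, L, hc, hU, hyU, hL, hs, hYU⟩ := hY.image_linearEquiv σ y hyσ
    have hY' : ∀ b ∈ U, (b ∈ σ '' Y ↔ L b = 0) := fun b hb => by
      have := Set.ext_iff.1 hYU b
      simpa [hb] using this
    have hzero : ∀ᶠ b in 𝓝[Y] (y : V), L b = 0 := by
      refine hY.eventually_eq_zero y.2 (hL y hyU) ?_
      rw [← map_nhds_subtype_val, frequently_map]
      have hfreq : ∃ᶠ a in 𝓝 y, a ∈ interior ((↑) ⁻¹' (σ '' Y) : Set Y) :=
        mem_closure_iff_frequently.1 hy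
      have hUy : ∀ᶠ a : Y in 𝓝 y, (a : V) ∈ U :=
        continuous_subtype_val.continuousAt.eventually_mem (hU.mem_nhds hyU)
      refine (hfreq.and_eventually hUy).mono fun a ⟨ha, haU⟩ => ?_
      rw [mem_interior_iff_mem_nhds, preimage_coe_mem_nhds_subtype] at ha
      filter_upwards [ha, nhdsWithin_le_nhds (hU.mem_nhds haU)] with b hb hbU
      exact (hY' b hbU).1 hb
    rw [mem_interior_iff_mem_nhds, preimage_coe_mem_nhds_subtype]
    filter_upwards [hzero, nhdsWithin_le_nhds (hU.mem_nhds hyU)] with b hb hbU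
    exact (hY' b hbU).2 hb
  have := isPreconnected_iff_preconnectedSpace.1 hconn
  have huniv : interior ((↑) ⁻¹' (σ '' Y) : Set Y) = Set.univ :=
    IsClopen.eq_univ ⟨hclosed, isOpen_interior⟩ hne
  have hsub : Y ⊆ σ '' Y := fun y hy => by
    have h := interior_subset (Set.eq_univ_iff_forall.1 huniv ⟨y, hy⟩)
    exact h
  refine (Set.Subset.antisymm hsub ?_).symm
  obtain ⟨k, hk, hpow⟩ := (isOfFinOrder_iff_pow_eq_one).1
    ((isOfFinOrder_of_finite (⟨σ, hσ⟩ : W)))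
  have hpow' : σ ^ k = 1 := congrArg Subtype.val hpow
  -- Iterating `Y ⊆ σY` gives `Y ⊆ σ ^ (k - 1) Y`, whence `σY ⊆ σ ^ k Y = Y`.
  have hiter : ∀ j, ∀ y ∈ Y, y ∈ (σ ^ j : V ≃ₗ[ℂ] V) '' Y := by
    intro j
    induction j with
    | zero => exact fun y hy => ⟨y, hy, rfl⟩
    | succ j ih =>
      intro y hy
      obtain ⟨w, hw, rfl⟩ := ih y hy
      obtain ⟨u, hu, rfl⟩ := hsub hw
      exact ⟨u, hu, rfl⟩
  rintro _ ⟨y, hy, rfl⟩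
  obtain ⟨w, hw, hwy⟩ := hiter (k - 1) y hy
  have h₁ : σ ((σ ^ (k - 1) : V ≃ₗ[ℂ] V) w) = (σ ^ k : V ≃ₗ[ℂ] V) w := by
    conv_rhs => rw [← Nat.sub_add_cancel hk, pow_succ']
    rfl
  rw [← hwy, h₁, hpow']
  exact hw

end Proper

end ReflectionMapping

open ReflectionMapping in
theorem corollary2p6 {V : Type*} [NormedAddCommGroup V] [NormedSpace ℂ V] [FiniteDimensional ℂ V]
    (W : Subgroup (V ≃ₗ[ℂ] V)) (hW : IsReflectionGroup W)
    {p : ℕ} (ω : V → (Fin p → ℂ)) (hω : IsOrbitMap W ω)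
    {n : ℕ} (Y : Set V) (hY : IsComplexSubmanifold n Y)
    (hproper : IsProperMap (Set.rangeFactorization (reflectionMap ω Y))) :
    (GenericallyOneToOne (reflectionMap ω Y) ↔
      ∀ σ ∈ W, σ ≠ 1 → complexDim ((Y ∩ σ '' Y) \ {v | σ v = v}) + 1 ≤ (n : WithBot ℕ∞)) ∧
    ((∀ σ ∈ W, σ ≠ 1 → complexDim ((Y ∩ σ '' Y) \ {v | σ v = v}) + 1 ≤ (n : WithBot ℕ∞)) →
      ∀ σ ∈ W, σ '' Y = Y → ∀ y ∈ Y, σ y = y) ∧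
    (IsPreconnected Y → (∀ σ ∈ W, σ '' Y = Y → ∀ y ∈ Y, σ y = y) →
      ∀ σ ∈ W, σ ≠ 1 → complexDim ((Y ∩ σ '' Y) \ {v | σ v = v}) + 1 ≤ (n : WithBot ℕ∞)) := by
  have := hW.finite
  have hsub : ∀ σ : V ≃ₗ[ℂ] V, (Y ∩ σ '' Y) \ {v | σ v = v} ⊆ Y := fun σ v hv => hv.1.1
  simp only [fun σ => hY.interior_eq_empty_iff (hsub σ)]
  refine ⟨(genericallyOneToOne_iff_interior hω hY hproper).trans
    ⟨fun h σ hσ _ => h σ hσ, fun h σ hσ => ?_⟩, fun h σ hσ hσY y hy => ?_,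
    fun hconn h σ hσ _ => ?_⟩
  · by_cases h1 : σ = 1
    · simp [h1]
    · exact h σ hσ h1
  · by_cases h1 : σ = 1
    · simp [h1]
    · by_contra hne
      have hopen : IsOpen {w : Y | σ w = w}ᶜ :=
        (isClosed_eq (σ.toContinuousLinearEquiv.continuous.comp continuous_subtype_val)
          continuous_subtype_val).isOpen_compl
      have h₁ := h σ hσ h1
      rw [hσY, Set.inter_self] at h₁
      refine Set.notMem_empty (⟨y, hy⟩ : Y) (h₁ ▸ interior_maximal ?_ hopen hne)
      exact fun w hw => ⟨w.2, hw⟩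
  · by_contra hne
    obtain ⟨y, hy⟩ := Set.nonempty_iff_ne_empty.2 hne
    have hσY := image_eq_of_interior_nonempty hω hY hproper hconn hσ
      ⟨y, interior_mono (fun w hw => hw.1.2) hy⟩
    exact (interior_subset hy).2 (h σ hσ hσY y y.2)
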